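/- For real $x$ let $\{x\}=x-\lfloor x\rfloor$ be the fractional part, let $A(x)=\{1/x\}$ be the Gauss map and $A_0(x)=\lfloor \frac1x+1\rfloor-\frac1x$ the by-excess map. For irrational $x$ define the ($1$-periodic) Brjuno function, semi-Brjuno function and Wilton function by $$B(x)=\sum_{j=0}^\infty \Big(\prod_{i=0}^{j-1}A^i(\{x\})\Big)\log\frac1{A^j(\{x\})}\in[0,\infty],\qquad B_0(x)=\sum_{j=0}^\infty \Big(\prod_{i=0}^{j-1}A_0^i(\{x\})\Big)\log\frac1{A_0^j(\{x\})}\in[0,\infty],$$ $$W(x)=\sum_{j=0}^\infty(-1)^j \Big(\prod_{i=0}^{j-1}A^i(\{x\})\Big)\log\frac1{A^j(\{x\})},$$ the last being the limit in $[-\infty,\infty]$ of the partial sums, where it exists. Let $B_0^\pm(x)=\frac12\big(B_0(x)\pm B_0(-x)\big)$ be the even and odd parts of $B_0$. Then there are constants $C^+$ and $C^-$ such that $$|B(x)-2B_0^+(x)|\le C^+\qquad\text{and}\qquad |W(x)-2B_0^-(x)|\le C^-$$ for all irrational numbers $x$, the second for all irrational $x$ at which $B_0^-(x)$ is defined, i.e.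 $B_0(x)$ and $B_0(-x)$ are not both $\infty$ (the existence of $W(x)\in[-\infty,\infty]$ at these $x$ being part of the claim). Here the inequality between two extended real numbers means that either both are finite and differ by at most the constant, or both are equal to the same infinity; in particular $B(x)=\infty$ if and only if $B_0(x)=\infty$ or $B_0(-x)=\infty$. -/

import Mathlib

open scoped ENNReal
open Filter Topology

noncomputable section

/-- The Gauss map `A(x) = {1/x}`. -/
def gaussMap (x : ℝ) : ℝ := Int.fract (1 / x)

/-- The by-excess map `A₀(x) = ⌊1/x + 1⌋ - 1/x`. -/
def byExcessMap (x : ℝ) : ℝ := (⌊1 / x + 1⌋ : ℝ) - 1 / x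

/-- For a continued fraction map `T`, the `j`-th summand
`({x} T({x}) ⋯ T^{j-1}({x})) * log (1 / T^j({x}))`; for `j = 0` it is `log (1 / {x})`. -/
def cfTerm (T : ℝ → ℝ) (x : ℝ) (j : ℕ) : ℝ :=
  (∏ i ∈ Finset.range j, T^[i] (Int.fract x)) * Real.log (1 / T^[j] (Int.fract x))

/-- If `T` maps irrationals to irrationals in `(0,1)`, so do its iterates, from `{x}` on. -/
theorem iterate_mem_Ioo {T : ℝ → ℝ}
    (hT : ∀ y, Irrational y → Irrational (T y) ∧ T y ∈ Set.Ioo (0 : ℝ) 1)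
    {x : ℝ} (hx : Irrational x) (j : ℕ) :
    Irrational (T^[j] (Int.fract x)) ∧ T^[j] (Int.fract x) ∈ Set.Ioo (0 : ℝ) 1 := by
  have hf : Irrational (Int.fract x) := hx.sub_intCast ⌊x⌋
  cases j with
  | zero =>
    exact ⟨hf, lt_of_le_of_ne (Int.fract_nonneg x) (Ne.symm hf.ne_zero), Int.fract_lt_one x⟩
  | succ n =>
    rw [Function.iterate_succ_apply']
    refine hT _ ?_
    induction n with
    | zero => exact hf
    | succ k ih =>
      rw [Function.iterate_succ_apply']
      exact (hT _ ih).1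

theorem gaussMap_mem (y : ℝ) (hy : Irrational y) :
    Irrational (gaussMap y) ∧ gaussMap y ∈ Set.Ioo (0 : ℝ) 1 := by
  have hi : Irrational (gaussMap y) := by
    have h : Irrational (1 / y) := by simpa using hy.inv
    exact h.sub_intCast ⌊1 / y⌋
  exact ⟨hi, lt_of_le_of_ne (Int.fract_nonneg _) (Ne.symm hi.ne_zero), Int.fract_lt_one _⟩

theorem byExcessMap_mem (y : ℝ) (hy : Irrational y) :
    Irrational (byExcessMap y) ∧ byExcessMap y ∈ Set.Ioo (0 : ℝ) 1 := by
  have hi : Irrational (byExcessMap y) := by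
    have h : Irrational (1 / y) := by simpa using hy.inv
    exact h.intCast_sub _
  have h1 := Int.floor_le (1 / y + 1)
  have h2 := Int.lt_floor_add_one (1 / y + 1)
  refine ⟨hi, by unfold byExcessMap; linarith, lt_of_le_of_ne ?_ hi.ne_one⟩
  unfold byExcessMap; linarith

/-- The summands are nonnegative at irrational points, so that taking the sums of their images
under `ENNReal.ofReal` below truncates nothing. -/
theorem cfTerm_nonneg {T : ℝ → ℝ}
    (hT : ∀ y, Irrational y → Irrational (T y) ∧ T y ∈ Set.Ioo (0 : ℝ) 1)
    {x : ℝ} (hx : Irrational x) (j : ℕ) : 0 ≤ cfTerm T x j := by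
  refine mul_nonneg (Finset.prod_nonneg fun i _ => (iterate_mem_Ioo hT hx i).2.1.le)
    (Real.log_nonneg ?_)
  have h := (iterate_mem_Ioo hT hx j).2
  exact (one_le_div h.1).2 h.2.le

/-- The Brjuno function `B`, with values in `[0,∞]` (at irrational points). -/
def brjuno (x : ℝ) : ℝ≥0∞ := ∑' j : ℕ, ENNReal.ofReal (cfTerm gaussMap x j)

/-- The semi-Brjuno function `B₀`, with values in `[0,∞]` (at irrational points). -/
def semiBrjuno (x : ℝ) : ℝ≥0∞ := ∑' j : ℕ, ENNReal.ofReal (cfTerm byExcessMap x j)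

/-- The even part `B₀⁺(x) = (B₀(x) + B₀(-x)) / 2`. -/
def semiBrjunoEven (x : ℝ) : EReal :=
  ((semiBrjuno x : EReal) + (semiBrjuno (-x) : EReal)) / 2

/-- The odd part `B₀⁻(x) = (B₀(x) - B₀(-x)) / 2`; meaningful unless `B₀(x) = B₀(-x) = ∞`. -/
def semiBrjunoOdd (x : ℝ) : EReal :=
  ((semiBrjuno x : EReal) - (semiBrjuno (-x) : EReal)) / 2

/-- The partial sums of the Wilton series
`∑ (-1)^j ({x} A({x}) ⋯ A^{j-1}({x})) * log (1 / A^j({x}))`. -/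
def wiltonPartialSum (x : ℝ) (n : ℕ) : ℝ :=
  ∑ j ∈ Finset.range n, (-1 : ℝ) ^ j * cfTerm gaussMap x j

/-- `W(x) = w`: the Wilton series at `x` has the sum `w ∈ [-∞,∞]`, as the limit of its
partial sums. -/
def IsWiltonValue (x : ℝ) (w : EReal) : Prop :=
  Tendsto (fun n => ((wiltonPartialSum x n : ℝ) : EReal)) atTop (𝓝 w)

/-- `|a - b| ≤ C` for extended reals: either both are finite and differ by at most `C`,
or they are the same infinity. -/
def DistLE (a b : EReal) (C : ℝ) : Prop :=
  (∃ r s : ℝ, a = r ∧ b = s ∧ |r - s| ≤ C) ∨ (a = ⊤ ∧ b = ⊤) ∨ (a = ⊥ ∧ b = ⊥)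

end

/-!
Let `E` and `O` be the sums of the terms of the Brjuno series with even and with odd index, so that
`B = E + O` and `W = E - O`. On the irrationals of `(0, 1)`, with `L x = log (1 / x)`, they are the
least nonnegative solution of
`E x = L x + x * O (A x)`, `O x = x * E (A x)`,
whereas `A₀ = 1 - A` makes `B₀` the least nonnegative solution of
`B₀ x = L x + x * B₀ (1 - A x)`.
Following the second recursion from `1 - x` through a full block of by-excess steps gives
`x * B₀ (A x) ≤ B₀ (1 - x)`, so `B₀ x` and `B₀ (1 - x)` dominate the first system and `E x ≤ B₀ x`,
`O x ≤ B₀ (1 - x)`. Conversely the minimum of `E x + 2` and `O (1 - x) + 2` dominates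
the second recursion, so `B₀ x ≤ E x + 2` and `B₀ (1 - x) ≤ O x + 2`.
Leastness replaces any estimate of remainders, hence everything holds in `[0, ∞]`.
-/

open scoped NNReal

theorem tsum_eq_add_mul_tsum {t u : ℕ → ℝ≥0∞} {w : ℝ≥0∞} (h : ∀ j, t (j + 1) = w * u j) :
    ∑' j, t j = t 0 + w * ∑' j, u j := by
  rw [tsum_eq_zero_add' ENNReal.summable, ← ENNReal.tsum_mul_left]
  simp only [h]

theorem tsum_le_of_add_mul_le {ι : Type*} {t : ι → ℕ → ℝ≥0∞} {T : ι → ι} {w F : ι → ℝ≥0∞}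
    (ht : ∀ i j, t i (j + 1) = w i * t (T i) j) (hF : ∀ i, t i 0 + w i * F (T i) ≤ F i) (i : ι) :
    ∑' j, t i j ≤ F i := by
  refine ENNReal.tsum_le_of_sum_range_le fun n => ?_
  induction n generalizing i with
  | zero => simp
  | succ n ih =>
    calc ∑ j ∈ Finset.range (n + 1), t i j
        = t i 0 + w i * ∑ j ∈ Finset.range n, t (T i) j := by
          simp only [Finset.sum_range_succ', ht, Finset.mul_sum, add_comm]
      _ ≤ t i 0 + w i * F (T i) := by gcongr; exact ih (T i)
      _ ≤ F i := hF i

theorem coe_sum_ofReal_sub_coe_sum_ofReal_neg {ι : Type*} (s : Finset ι) (a : ι → ℝ) :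
    ((∑ i ∈ s, ENNReal.ofReal (a i) : ℝ≥0∞) : EReal) - (∑ i ∈ s, ENNReal.ofReal (-a i) : ℝ≥0∞) =
      (∑ i ∈ s, a i : ℝ) := by
  have coe_sum_ofReal (b : ι → ℝ) :
      ((∑ i ∈ s, ENNReal.ofReal (b i) : ℝ≥0∞) : EReal) = (∑ i ∈ s, max (b i) 0 : ℝ) := by
    rw [← EReal.coe_ennreal_toReal (by simp), ENNReal.toReal_sum (by simp)]
    simp only [ENNReal.toReal_ofReal']
  rw [coe_sum_ofReal, coe_sum_ofReal, ← EReal.coe_sub, ← Finset.sum_sub_distrib]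
  simp only [max_zero_sub_max_neg_zero_eq_self]

theorem tendsto_coe_ereal_sum_range {a : ℕ → ℝ}
    (h : ∑' j, ENNReal.ofReal (a j) ≠ ⊤ ∨ ∑' j, ENNReal.ofReal (-a j) ≠ ⊤) :
    Tendsto (fun n => ((∑ j ∈ Finset.range n, a j : ℝ) : EReal)) atTop
      (𝓝 ((∑' j, ENNReal.ofReal (a j) : ℝ≥0∞) - (∑' j, ENNReal.ofReal (-a j) : ℝ≥0∞))) := by
  have tendsto_coe (b : ℕ → ℝ≥0∞) :
      Tendsto (fun n => ((∑ j ∈ Finset.range n, b j : ℝ≥0∞) : EReal)) atTop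
        (𝓝 (∑' j, b j : ℝ≥0∞)) :=
    (continuous_coe_ennreal_ereal.tendsto _).comp (ENNReal.tendsto_nat_tsum b)
  simp only [← coe_sum_ofReal_sub_coe_sum_ofReal_neg, sub_eq_add_neg]
  refine (EReal.continuousAt_add (p := (_, -_)) ?_ (Or.inl (by simp))).tendsto.comp
    ((tendsto_coe _).prodMk_nhds ((continuous_neg.tendsto _).comp (tendsto_coe _)))
  simpa using h

theorem distLE_sub_of_le_of_le_add {a b a' b' : ℝ≥0∞} {C : ℝ≥0} (ha : a ≤ a') (ha' : a' ≤ a + C)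
    (hb : b ≤ b') (hb' : b' ≤ b + C) (h : a ≠ ⊤ ∨ b ≠ ⊤) : DistLE (a - b) (a' - b') C := by
  rcases eq_or_ne a ⊤ with rfl | ha_top
  · have hb_top : b ≠ ⊤ := h.resolve_left (by simp)
    have hb_top' : b' ≠ ⊤ := ne_top_of_le_ne_top (by finiteness) hb'
    lift b to ℝ≥0 using hb_top
    lift b' to ℝ≥0 using hb_top'
    exact Or.inr (Or.inl ⟨EReal.top_sub_coe b, top_le_iff.1 ha ▸ EReal.top_sub_coe b'⟩)
  have ha_top' : a' ≠ ⊤ := ne_top_of_le_ne_top (by finiteness) ha'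
  lift a to ℝ≥0 using ha_top
  lift a' to ℝ≥0 using ha_top'
  rcases eq_or_ne b ⊤ with rfl | hb_top
  · exact Or.inr (Or.inr ⟨EReal.sub_top (a : ℝ), top_le_iff.1 hb ▸ EReal.sub_top (a' : ℝ)⟩)
  have hb_top' : b' ≠ ⊤ := ne_top_of_le_ne_top (by finiteness) hb'
  lift b to ℝ≥0 using hb_top
  lift b' to ℝ≥0 using hb_top'
  norm_cast at ha ha' hb hb'
  rw [← NNReal.coe_le_coe] at ha ha' hb hb'
  push_cast at ha' hb'
  exact Or.inl ⟨a - b, a' - b', rfl, rfl, abs_le.2 ⟨by linarith, by linarith⟩⟩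

theorem distLE_of_le_of_le_add {a b : ℝ≥0∞} {C : ℝ≥0} (hab : a ≤ b) (hba : b ≤ a + C) :
    DistLE a b C := by
  simpa using distLE_sub_of_le_of_le_add hab hba le_rfl zero_le (Or.inr ENNReal.zero_ne_top)

/-- The irrational points of the open unit interval, on which both continued fraction maps act. -/
abbrev UnitIrrational : Type := {x : ℝ // Irrational x ∧ x ∈ Set.Ioo (0 : ℝ) 1}

namespace UnitIrrational

theorem pos (x : UnitIrrational) : 0 < (x : ℝ) := x.2.2.1

theorem lt_one (x : UnitIrrational) : (x : ℝ) < 1 := x.2.2.2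

theorem fract_coe (x : UnitIrrational) : Int.fract (x : ℝ) = x :=
  Int.fract_eq_self.2 ⟨x.pos.le, x.lt_one⟩

theorem log_one_div_nonneg (x : UnitIrrational) : 0 ≤ Real.log (1 / x) :=
  Real.log_nonneg ((one_le_div x.pos).2 x.lt_one.le)

theorem lt_half_or_half_lt (x : UnitIrrational) : (x : ℝ) < 1 / 2 ∨ 1 / 2 < (x : ℝ) :=
  lt_or_gt_of_ne fun h => x.2.1 ⟨1 / 2, by rw [h]; norm_num⟩

/-- The Gauss map as a self-map of the irrationals of the unit interval. -/
noncomputable def gauss (x : UnitIrrational) : UnitIrrational := ⟨gaussMap x, gaussMap_mem x x.2.1⟩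

/-- The involution `x ↦ 1 - x`. It turns the Gauss map into the by-excess map, and it is the effect
of `x ↦ -x` on fractional parts. -/
def reflect (x : UnitIrrational) : UnitIrrational :=
  ⟨1 - x, by simpa using x.2.1.intCast_sub 1, by linarith [x.lt_one], by linarith [x.pos]⟩

theorem coe_gauss (x : UnitIrrational) : (x.gauss : ℝ) = gaussMap x := rfl

theorem coe_reflect (x : UnitIrrational) : (x.reflect : ℝ) = 1 - x := rfl

theorem reflect_reflect (x : UnitIrrational) : x.reflect.reflect = x :=
  Subtype.ext (sub_sub_cancel 1 (x : ℝ))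

theorem byExcessMap_coe (x : UnitIrrational) : byExcessMap x = x.gauss.reflect := by
  simp only [coe_reflect, coe_gauss, byExcessMap, gaussMap, Int.floor_add_one, Int.fract]
  push_cast
  ring

theorem coe_gauss_of_half_lt {x : UnitIrrational} (h : 1 / 2 < (x : ℝ)) :
    (x.gauss : ℝ) = 1 / x - 1 := by
  have one_lt : 1 < 1 / (x : ℝ) := (one_lt_div x.pos).2 x.lt_one
  have lt_two : 1 / (x : ℝ) < 2 := by rw [div_lt_iff₀ x.pos]; linarith
  have floor_eq : ⌊1 / (x : ℝ)⌋ = 1 :=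
    Int.floor_eq_iff.2 ⟨by push_cast; linarith, by push_cast; linarith⟩
  rw [coe_gauss, gaussMap, Int.fract, floor_eq, Int.cast_one]

theorem mul_gauss_of_half_lt {x : UnitIrrational} (h : 1 / 2 < (x : ℝ)) :
    (x * x.gauss : ℝ) = x.reflect := by
  have := x.pos
  rw [coe_gauss_of_half_lt h, coe_reflect]
  field_simp

theorem gauss_gauss_of_half_lt {x : UnitIrrational} (h : 1 / 2 < (x : ℝ)) :
    x.gauss.gauss = x.reflect.gauss := by
  have inv_gauss : 1 / (x.gauss : ℝ) = 1 / x.reflect - 1 := by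
    have := x.pos
    have := x.gauss.pos
    have := x.reflect.pos
    have mul_gauss := mul_gauss_of_half_lt h
    rw [coe_reflect] at *
    field_simp
    linarith
  refine Subtype.ext ?_
  rw [coe_gauss, gaussMap, inv_gauss, Int.fract_sub_one, coe_gauss, gaussMap]

theorem half_lt_reflect {x : UnitIrrational} (h : (x : ℝ) < 1 / 2) : 1 / 2 < (x.reflect : ℝ) := by
  rw [coe_reflect]
  linarith

theorem reflect_mul_gauss_reflect_of_lt_half {x : UnitIrrational} (h : (x : ℝ) < 1 / 2) :
    (x.reflect * x.reflect.gauss : ℝ) = x := by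
  rw [mul_gauss_of_half_lt (half_lt_reflect h), reflect_reflect]

theorem gauss_gauss_reflect_of_lt_half {x : UnitIrrational} (h : (x : ℝ) < 1 / 2) :
    x.reflect.gauss.gauss = x.gauss := by
  rw [gauss_gauss_of_half_lt (half_lt_reflect h), reflect_reflect]

-- Below `1 / 2` the map `x ↦ A (1 - x) = x / (1 - x)` lowers `1 / x` by one.
theorem induction_half {p : UnitIrrational → Prop}
    (half_lt : ∀ x : UnitIrrational, 1 / 2 < (x : ℝ) → p x)
    (lt_half : ∀ x : UnitIrrational, (x : ℝ) < 1 / 2 → p x.reflect.gauss → p x)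
    (x : UnitIrrational) : p x := by
  have of_one_lt_mul (n : ℕ) : ∀ y : UnitIrrational, 1 < (n + 2) * (y : ℝ) → p y := by
    induction n with
    | zero => exact fun y hy => half_lt y (by push_cast at hy; linarith)
    | succ n ih =>
      intro y hy
      rcases y.lt_half_or_half_lt with h | h
      · refine lt_half y h (ih _ ?_)
        have hmul := reflect_mul_gauss_reflect_of_lt_half h
        refine lt_of_mul_lt_mul_left ?_ y.reflect.pos.le
        rw [mul_left_comm, hmul, coe_reflect]
        push_cast at hy
        linarith
      · exact half_lt y h
  obtain ⟨n, hn⟩ := exists_nat_gt (1 / (x : ℝ))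
  rw [div_lt_iff₀ x.pos] at hn
  exact of_one_lt_mul n x (by linarith [x.pos])

end UnitIrrational

/-- The summand `log (1 / x)` common to the recursions of all three series, valued in `[0, ∞]` as
they are. -/
noncomputable def logInv (x : ℝ) : ℝ≥0∞ := ENNReal.ofReal (Real.log (1 / x))

namespace UnitIrrational

theorem log_one_div_reflect_of_half_lt {x : UnitIrrational} (h : 1 / 2 < (x : ℝ)) :
    Real.log (1 / x.reflect) = Real.log (1 / x) + Real.log (1 / x.gauss) := by
  rw [← mul_gauss_of_half_lt h, ← one_div_mul_one_div,
    Real.log_mul (one_div_pos.2 x.pos).ne' (one_div_pos.2 x.gauss.pos).ne']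

theorem log_one_div_reflect_le_of_lt_half {x : UnitIrrational} (h : (x : ℝ) < 1 / 2) :
    Real.log (1 / x.reflect) ≤ 2 * x := by
  have := x.pos
  calc Real.log (1 / x.reflect) ≤ 1 / x.reflect - 1 :=
        Real.log_le_sub_one_of_pos (one_div_pos.2 x.reflect.pos)
    _ ≤ 2 * x := by
        rw [sub_le_iff_le_add, div_le_iff₀ x.reflect.pos, coe_reflect]
        nlinarith

theorem log_one_div_reflect_le_of_half_lt {x : UnitIrrational} (h : 1 / 2 < (x : ℝ)) :
    Real.log (1 / x.reflect) ≤ 2 * x + x * Real.log (1 / x.gauss) := by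
  have log_le : Real.log (1 / x) ≤ x.gauss := by
    rw [coe_gauss_of_half_lt h]
    exact Real.log_le_sub_one_of_pos (one_div_pos.2 x.pos)
  have mul_log_le : (1 - x) * Real.log (1 / x.gauss) ≤ 2 * x - 1 :=
    calc (1 - x) * Real.log (1 / x.gauss)
        ≤ (1 - x) * (1 / x.gauss - 1) :=
          mul_le_mul_of_nonneg_left
            (Real.log_le_sub_one_of_pos (one_div_pos.2 x.gauss.pos)) x.reflect.pos.le
      _ = 2 * x - 1 := by
          have := x.gauss.pos
          have mul_gauss := mul_gauss_of_half_lt h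
          rw [coe_reflect] at mul_gauss
          field_simp
          linarith
  rw [log_one_div_reflect_of_half_lt h]
  linarith [x.gauss.lt_one]

theorem mul_logInv_gauss_le_of_half_lt {x : UnitIrrational} (h : 1 / 2 < (x : ℝ)) :
    ENNReal.ofReal x * logInv x.gauss ≤ logInv x.reflect := by
  calc ENNReal.ofReal x * logInv x.gauss ≤ logInv x.gauss :=
        mul_le_of_le_one_left' (ENNReal.ofReal_le_one.2 x.lt_one.le)
    _ ≤ logInv x.reflect := by
        refine ENNReal.ofReal_le_ofReal ?_
        rw [log_one_div_reflect_of_half_lt h]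
        exact le_add_of_nonneg_left x.log_one_div_nonneg

theorem ofReal_two_mul_add_ofReal_reflect_mul_two (x : UnitIrrational) :
    ENNReal.ofReal (2 * x) + ENNReal.ofReal x.reflect * 2 = 2 := by
  rw [ENNReal.ofReal_mul zero_le_two, ENNReal.ofReal_ofNat, mul_comm, ← add_mul,
    ← ENNReal.ofReal_add x.pos.le x.reflect.pos.le, coe_reflect, add_sub_cancel,
    ENNReal.ofReal_one, one_mul]

theorem logInv_reflect_add_le_of_lt_half {x : UnitIrrational} (h : (x : ℝ) < 1 / 2) :
    logInv x.reflect + ENNReal.ofReal x.reflect * 2 ≤ 2 := by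
  calc logInv x.reflect + ENNReal.ofReal x.reflect * 2
      ≤ ENNReal.ofReal (2 * x) + ENNReal.ofReal x.reflect * 2 := by
        gcongr
        exact ENNReal.ofReal_le_ofReal (log_one_div_reflect_le_of_lt_half h)
    _ = 2 := x.ofReal_two_mul_add_ofReal_reflect_mul_two

theorem logInv_reflect_add_le_of_half_lt {x : UnitIrrational} (h : 1 / 2 < (x : ℝ)) :
    logInv x.reflect + ENNReal.ofReal x.reflect * 2 ≤ 2 + ENNReal.ofReal x * logInv x.gauss := by
  have logInv_le :
      logInv x.reflect ≤ ENNReal.ofReal (2 * x) + ENNReal.ofReal x * logInv x.gauss := by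
    refine (ENNReal.ofReal_le_ofReal (log_one_div_reflect_le_of_half_lt h)).trans ?_
    rw [logInv, ← ENNReal.ofReal_mul x.pos.le]
    exact ENNReal.ofReal_add_le
  calc logInv x.reflect + ENNReal.ofReal x.reflect * 2
      ≤ ENNReal.ofReal (2 * x) + ENNReal.ofReal x * logInv x.gauss +
          ENNReal.ofReal x.reflect * 2 := by gcongr
    _ = 2 + ENNReal.ofReal x * logInv x.gauss := by
        rw [add_right_comm, ofReal_two_mul_add_ofReal_reflect_mul_two]

end UnitIrrational

theorem cfTerm_fract (T : ℝ → ℝ) (x : ℝ) (j : ℕ) : cfTerm T (Int.fract x) j = cfTerm T x j := by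
  simp only [cfTerm, Int.fract_fract]

/-- The `j`-th summand of the Wilton series. -/
noncomputable def wiltonTerm (x : ℝ) (j : ℕ) : ℝ := (-1) ^ j * cfTerm gaussMap x j

/-- The sum of the positive parts of the terms of the Wilton series. It consists of the
even-indexed terms of the Brjuno series. -/
noncomputable def wiltonPos (x : ℝ) : ℝ≥0∞ := ∑' j, ENNReal.ofReal (wiltonTerm x j)

/-- The sum of the negative parts of the terms of the Wilton series. It consists of the
odd-indexed terms of the Brjuno series. -/
noncomputable def wiltonNeg (x : ℝ) : ℝ≥0∞ := ∑' j, ENNReal.ofReal (-wiltonTerm x j)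

theorem isWiltonValue_wiltonPos_sub_wiltonNeg {x : ℝ} (h : wiltonPos x ≠ ⊤ ∨ wiltonNeg x ≠ ⊤) :
    IsWiltonValue x (wiltonPos x - wiltonNeg x) :=
  tendsto_coe_ereal_sum_range h

theorem brjuno_eq_wiltonPos_add_wiltonNeg {x : ℝ} (hx : Irrational x) :
    brjuno x = wiltonPos x + wiltonNeg x := by
  rw [brjuno, wiltonPos, wiltonNeg, ← ENNReal.tsum_add]
  refine tsum_congr fun j => ?_
  have := cfTerm_nonneg gaussMap_mem hx j
  rcases neg_one_pow_eq_or ℝ j with h | h <;>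
    simp [wiltonTerm, h, ENNReal.ofReal_of_nonpos, this]

namespace UnitIrrational

theorem cfTerm_zero (T : ℝ → ℝ) (x : UnitIrrational) : cfTerm T x 0 = Real.log (1 / x) := by
  simp [cfTerm, fract_coe]

theorem cfTerm_succ {T : ℝ → ℝ} {x y : UnitIrrational} (h : T x = y) (j : ℕ) :
    cfTerm T x (j + 1) = x * cfTerm T y j := by
  simp only [cfTerm, fract_coe, Finset.prod_range_succ', Function.iterate_succ_apply,
    Function.iterate_zero, id, h]
  ring

theorem wiltonTerm_zero (x : UnitIrrational) : wiltonTerm x 0 = Real.log (1 / x) := by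
  rw [wiltonTerm, cfTerm_zero, pow_zero, one_mul]

theorem wiltonTerm_succ (x : UnitIrrational) (j : ℕ) :
    wiltonTerm x (j + 1) = x * -wiltonTerm x.gauss j := by
  rw [wiltonTerm, wiltonTerm, cfTerm_succ x.coe_gauss.symm]
  ring

theorem ofReal_neg_wiltonTerm_zero (x : UnitIrrational) :
    ENNReal.ofReal (-wiltonTerm x 0) = 0 := by
  rw [wiltonTerm_zero, ENNReal.ofReal_of_nonpos (neg_nonpos.2 x.log_one_div_nonneg)]

theorem ofReal_cfTerm_byExcessMap_succ (x : UnitIrrational) (j : ℕ) :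
    ENNReal.ofReal (cfTerm byExcessMap x (j + 1)) =
      ENNReal.ofReal x * ENNReal.ofReal (cfTerm byExcessMap x.gauss.reflect j) := by
  rw [cfTerm_succ x.byExcessMap_coe, ENNReal.ofReal_mul x.pos.le]

theorem ofReal_wiltonTerm_succ (x : UnitIrrational) (j : ℕ) :
    ENNReal.ofReal (wiltonTerm x (j + 1)) =
      ENNReal.ofReal x * ENNReal.ofReal (-wiltonTerm x.gauss j) := by
  rw [wiltonTerm_succ, ENNReal.ofReal_mul x.pos.le]

theorem ofReal_neg_wiltonTerm_succ (x : UnitIrrational) (j : ℕ) :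
    ENNReal.ofReal (-wiltonTerm x (j + 1)) =
      ENNReal.ofReal x * ENNReal.ofReal (wiltonTerm x.gauss j) := by
  rw [wiltonTerm_succ, mul_neg, neg_neg, ENNReal.ofReal_mul x.pos.le]

theorem semiBrjuno_eq (x : UnitIrrational) :
    semiBrjuno x = logInv x + ENNReal.ofReal x * semiBrjuno x.gauss.reflect := by
  rw [semiBrjuno, tsum_eq_add_mul_tsum x.ofReal_cfTerm_byExcessMap_succ, cfTerm_zero, logInv,
    semiBrjuno]

theorem wiltonPos_eq (x : UnitIrrational) :
    wiltonPos x = logInv x + ENNReal.ofReal x * wiltonNeg x.gauss := by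
  rw [wiltonPos, tsum_eq_add_mul_tsum x.ofReal_wiltonTerm_succ, wiltonTerm_zero, logInv, wiltonNeg]

theorem wiltonNeg_eq (x : UnitIrrational) :
    wiltonNeg x = ENNReal.ofReal x * wiltonPos x.gauss := by
  rw [wiltonNeg, tsum_eq_add_mul_tsum x.ofReal_neg_wiltonTerm_succ, ofReal_neg_wiltonTerm_zero,
    zero_add, wiltonPos]

theorem semiBrjuno_le {F : UnitIrrational → ℝ≥0∞}
    (hF : ∀ x : UnitIrrational, logInv x + ENNReal.ofReal x * F x.gauss.reflect ≤ F x)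
    (x : UnitIrrational) : semiBrjuno x ≤ F x :=
  tsum_le_of_add_mul_le (t := fun (x : UnitIrrational) j => ENNReal.ofReal (cfTerm byExcessMap x j))
    ofReal_cfTerm_byExcessMap_succ (fun x => by simpa only [cfTerm_zero, logInv] using hF x) x

theorem wiltonPos_le_and_wiltonNeg_le {P Q : UnitIrrational → ℝ≥0∞}
    (hP : ∀ x : UnitIrrational, logInv x + ENNReal.ofReal x * Q x.gauss ≤ P x)
    (hQ : ∀ x : UnitIrrational, ENNReal.ofReal x * P x.gauss ≤ Q x) (x : UnitIrrational) :
    wiltonPos x ≤ P x ∧ wiltonNeg x ≤ Q x := by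
  have sum_elim_le := tsum_le_of_add_mul_le
    (t := Sum.elim (fun (x : UnitIrrational) j => ENNReal.ofReal (wiltonTerm x j))
      (fun (x : UnitIrrational) j => ENNReal.ofReal (-wiltonTerm x j)))
    (T := Sum.elim (fun x => .inr x.gauss) (fun x => .inl x.gauss))
    (w := Sum.elim (fun x => ENNReal.ofReal x) (fun x => ENNReal.ofReal x)) (F := Sum.elim P Q)
    (Sum.rec ofReal_wiltonTerm_succ ofReal_neg_wiltonTerm_succ)
    (Sum.rec (fun x => by
        simpa only [Sum.elim_inl, Sum.elim_inr, wiltonTerm_zero, logInv] using hP x)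
      (fun x => by
        simpa only [Sum.elim_inl, Sum.elim_inr, ofReal_neg_wiltonTerm_zero, zero_add] using hQ x))
  exact ⟨sum_elim_le (.inl x), sum_elim_le (.inr x)⟩

theorem mul_semiBrjuno_gauss_le_semiBrjuno_reflect (x : UnitIrrational) :
    ENNReal.ofReal x * semiBrjuno x.gauss ≤ semiBrjuno x.reflect := by
  induction x using induction_half with
  | half_lt x h =>
    calc ENNReal.ofReal x * semiBrjuno x.gauss
        = ENNReal.ofReal x * logInv x.gauss +
            ENNReal.ofReal x.reflect * semiBrjuno x.gauss.gauss.reflect := by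
          rw [semiBrjuno_eq x.gauss, mul_add, ← mul_assoc, ← ENNReal.ofReal_mul x.pos.le,
            mul_gauss_of_half_lt h]
      _ ≤ logInv x.reflect + ENNReal.ofReal x.reflect * semiBrjuno x.gauss.gauss.reflect := by
          gcongr
          exact mul_logInv_gauss_le_of_half_lt h
      _ = semiBrjuno x.reflect := by
          rw [semiBrjuno_eq x.reflect, gauss_gauss_of_half_lt h]
  | lt_half x h ih =>
    calc ENNReal.ofReal x * semiBrjuno x.gauss
        = ENNReal.ofReal x.reflect *
            (ENNReal.ofReal x.reflect.gauss * semiBrjuno x.reflect.gauss.gauss) := by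
          rw [gauss_gauss_reflect_of_lt_half h, ← mul_assoc, ← ENNReal.ofReal_mul x.reflect.pos.le,
            reflect_mul_gauss_reflect_of_lt_half h]
      _ ≤ ENNReal.ofReal x.reflect * semiBrjuno x.reflect.gauss.reflect := by gcongr
      _ ≤ semiBrjuno x.reflect := by
          rw [semiBrjuno_eq x.reflect]
          exact le_add_self

theorem wiltonPos_le_semiBrjuno_and_wiltonNeg_le (x : UnitIrrational) :
    wiltonPos x ≤ semiBrjuno x ∧ wiltonNeg x ≤ semiBrjuno x.reflect :=
  wiltonPos_le_and_wiltonNeg_le (P := fun x => semiBrjuno x) (Q := fun x => semiBrjuno x.reflect)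
    (fun x => x.semiBrjuno_eq.ge) mul_semiBrjuno_gauss_le_semiBrjuno_reflect x

theorem logInv_add_mul_wiltonNeg_add_two_le (x : UnitIrrational) :
    logInv x + ENNReal.ofReal x * (wiltonNeg x.gauss + 2) ≤ wiltonPos x + 2 := by
  rw [wiltonPos_eq x, mul_add, ← add_assoc]
  gcongr
  exact mul_le_of_le_one_left' (ENNReal.ofReal_le_one.2 x.lt_one.le)

theorem logInv_reflect_add_mul_wiltonNeg_add_two_le (x : UnitIrrational) :
    logInv x.reflect + ENNReal.ofReal x.reflect * (wiltonNeg x.reflect.gauss + 2) ≤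
      wiltonNeg x + 2 := by
  rw [mul_add, add_left_comm]
  rcases x.lt_half_or_half_lt with h | h
  · calc ENNReal.ofReal x.reflect * wiltonNeg x.reflect.gauss +
          (logInv x.reflect + ENNReal.ofReal x.reflect * 2)
        = wiltonNeg x + (logInv x.reflect + ENNReal.ofReal x.reflect * 2) := by
          rw [wiltonNeg_eq x.reflect.gauss, gauss_gauss_reflect_of_lt_half h, ← mul_assoc,
            ← ENNReal.ofReal_mul x.reflect.pos.le, reflect_mul_gauss_reflect_of_lt_half h,
            ← wiltonNeg_eq]
      _ ≤ wiltonNeg x + 2 := by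
          gcongr
          exact logInv_reflect_add_le_of_lt_half h
  · calc ENNReal.ofReal x.reflect * wiltonNeg x.reflect.gauss +
          (logInv x.reflect + ENNReal.ofReal x.reflect * 2)
        ≤ ENNReal.ofReal x.reflect * wiltonNeg x.reflect.gauss +
          (2 + ENNReal.ofReal x * logInv x.gauss) := by
          gcongr _ + ?_
          exact logInv_reflect_add_le_of_half_lt h
      _ = wiltonNeg x + 2 := by
          rw [wiltonNeg_eq x, wiltonPos_eq x.gauss, gauss_gauss_of_half_lt h, mul_add, ← mul_assoc,
            ← ENNReal.ofReal_mul x.pos.le, mul_gauss_of_half_lt h]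
          ring

theorem semiBrjuno_le_wilton_add_two (x : UnitIrrational) :
    semiBrjuno x ≤ (wiltonPos x + 2) ⊓ (wiltonNeg x.reflect + 2) := by
  refine semiBrjuno_le (F := fun x => (wiltonPos x + 2) ⊓ (wiltonNeg x.reflect + 2))
    (fun x => ?_) x
  have step_le : logInv x + ENNReal.ofReal x * ((wiltonPos x.gauss.reflect + 2) ⊓
      (wiltonNeg x.gauss.reflect.reflect + 2)) ≤
      logInv x + ENNReal.ofReal x * (wiltonNeg x.gauss + 2) := by
    rw [reflect_reflect]
    gcongr
    exact inf_le_right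
  refine le_inf (step_le.trans x.logInv_add_mul_wiltonNeg_add_two_le) (step_le.trans ?_)
  simpa only [reflect_reflect] using x.reflect.logInv_reflect_add_mul_wiltonNeg_add_two_le

end UnitIrrational

namespace UnitIrrational

section Fract

/-- The fractional part of an irrational number, through which bounds on `UnitIrrational` extend to
all irrationals. -/
noncomputable def fract {x : ℝ} (hx : Irrational x) : UnitIrrational :=
  ⟨Int.fract x, iterate_mem_Ioo gaussMap_mem hx 0⟩

variable {x : ℝ} (hx : Irrational x)

theorem semiBrjuno_fract : semiBrjuno (fract hx) = semiBrjuno x := by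
  simp only [fract, semiBrjuno, cfTerm_fract]

theorem semiBrjuno_reflect_fract : semiBrjuno (fract hx).reflect = semiBrjuno (-x) := by
  rw [coe_reflect, fract, ← Int.fract_neg (fract hx).pos.ne']
  simp only [semiBrjuno, cfTerm_fract]

theorem wiltonPos_fract : wiltonPos (fract hx) = wiltonPos x := by
  simp only [fract, wiltonPos, wiltonTerm, cfTerm_fract]

theorem wiltonNeg_fract : wiltonNeg (fract hx) = wiltonNeg x := by
  simp only [fract, wiltonNeg, wiltonTerm, cfTerm_fract]

end Fract

end UnitIrrational

section Irrational

variable {x : ℝ} (hx : Irrational x)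
include hx

theorem wiltonPos_le_semiBrjuno : wiltonPos x ≤ semiBrjuno x := by
  simpa only [UnitIrrational.wiltonPos_fract, UnitIrrational.semiBrjuno_fract] using
    (UnitIrrational.fract hx).wiltonPos_le_semiBrjuno_and_wiltonNeg_le.1

theorem wiltonNeg_le_semiBrjuno_neg : wiltonNeg x ≤ semiBrjuno (-x) := by
  simpa only [UnitIrrational.wiltonNeg_fract, UnitIrrational.semiBrjuno_reflect_fract] using
    (UnitIrrational.fract hx).wiltonPos_le_semiBrjuno_and_wiltonNeg_le.2

theorem semiBrjuno_le_wiltonPos_add_two : semiBrjuno x ≤ wiltonPos x + 2 := by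
  simpa only [UnitIrrational.wiltonPos_fract, UnitIrrational.semiBrjuno_fract] using
    ((UnitIrrational.fract hx).semiBrjuno_le_wilton_add_two.trans inf_le_left)

theorem semiBrjuno_neg_le_wiltonNeg_add_two : semiBrjuno (-x) ≤ wiltonNeg x + 2 := by
  simpa only [UnitIrrational.reflect_reflect, UnitIrrational.wiltonNeg_fract,
    UnitIrrational.semiBrjuno_reflect_fract] using
    ((UnitIrrational.fract hx).reflect.semiBrjuno_le_wilton_add_two.trans inf_le_right)

end Irrational

theorem two_mul_div_two_ereal (a : EReal) : 2 * (a / 2) = a :=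
  EReal.mul_div_cancel (by decide) (by decide) (by norm_num)

theorem distLE_brjuno_two_mul_semiBrjunoEven {x : ℝ} (hx : Irrational x) :
    DistLE (brjuno x) (2 * semiBrjunoEven x) 4 := by
  rw [semiBrjunoEven, two_mul_div_two_ereal, brjuno_eq_wiltonPos_add_wiltonNeg hx,
    ← EReal.coe_ennreal_add]
  refine distLE_of_le_of_le_add (C := 4)
    (add_le_add (wiltonPos_le_semiBrjuno hx) (wiltonNeg_le_semiBrjuno_neg hx)) ?_
  calc semiBrjuno x + semiBrjuno (-x) ≤ (wiltonPos x + 2) + (wiltonNeg x + 2) :=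
        add_le_add (semiBrjuno_le_wiltonPos_add_two hx) (semiBrjuno_neg_le_wiltonNeg_add_two hx)
    _ = wiltonPos x + wiltonNeg x + (4 : ℝ≥0) := by push_cast; ring

theorem distLE_wilton_two_mul_semiBrjunoOdd {x : ℝ} (hx : Irrational x)
    (h : wiltonPos x ≠ ⊤ ∨ wiltonNeg x ≠ ⊤) :
    DistLE (wiltonPos x - wiltonNeg x) (2 * semiBrjunoOdd x) 2 := by
  rw [semiBrjunoOdd, two_mul_div_two_ereal]
  exact distLE_sub_of_le_of_le_add (C := 2) (wiltonPos_le_semiBrjuno hx)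
    (semiBrjuno_le_wiltonPos_add_two hx) (wiltonNeg_le_semiBrjuno_neg hx)
    (semiBrjuno_neg_le_wiltonNeg_add_two hx) h

theorem theorem1 :
    (∃ Cp : ℝ, ∀ x : ℝ, Irrational x →
      DistLE (brjuno x : EReal) (2 * semiBrjunoEven x) Cp) ∧
    (∃ Cm : ℝ, ∀ x : ℝ, Irrational x → ¬ (semiBrjuno x = ⊤ ∧ semiBrjuno (-x) = ⊤) →
      ∃ w : EReal, IsWiltonValue x w ∧ DistLE w (2 * semiBrjunoOdd x) Cm) := by
  refine ⟨⟨4, fun x hx => distLE_brjuno_two_mul_semiBrjunoEven hx⟩, ⟨2, fun x hx hfin => ?_⟩⟩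
  have wilton_ne_top : wiltonPos x ≠ ⊤ ∨ wiltonNeg x ≠ ⊤ :=
    (not_and_or.1 hfin).imp (ne_top_of_le_ne_top · (wiltonPos_le_semiBrjuno hx))
      (ne_top_of_le_ne_top · (wiltonNeg_le_semiBrjuno_neg hx))
  exact ⟨wiltonPos x - wiltonNeg x, isWiltonValue_wiltonPos_sub_wiltonNeg wilton_ne_top,
    distLE_wilton_two_mul_semiBrjunoOdd hx wilton_ne_top⟩
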